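/- **Setting.** Let $\Omega$ be a set of finitary operations containing the constant $0$ as its only constant, the unary $-$, the binary $+$, further unary operations $\Omega_1'$ and further binary operations $\Omega_2'$, where for each $\star\in\Omega_2'$ the opposite operation $a\star^{\circ}b=b\star a$ is also in $\Omega_2'$. Let $\mathbb E$ be a set of identities that contains the group laws for $(0,-,+)$ (commutativity is not required), $a\star(b+c)=a\star b+a\star c$, $\omega(a+b)=\omega(a)+\omega(b)$ and $\omega(a)\star b=\omega(a\star b)$ for $\omega\in\Omega_1'$, $\star\in\Omega_2'$. Let $\mathsf{TC}$ be the category of topological groups with operations determined by $(\Omega,\mathbb E)$: its objects are the topological groups with continuous operations $\Omega$ satisfying $\mathbb E$, its morphisms are the continuous homomorphisms that preserve all operations. *Internal groupoids.* An internal groupoid $G$ in $\mathsf{TC}$ is a category whose arrows and objects form objects $G$ and $G_0$ of $\mathsf{TC}$, and whose source and target maps $d_0,d_1\colon G\to G_0$, identity map $\varepsilon\colon G_0\to G$ and composition $G\,{}_{d_1}\!\times_{d_0}G\to G$ are morphisms of $\mathsf{TC}$ (it is then automatically a groupoid). A morphism $f\colon H\to G$ in $\mathrm{Cat}(\mathsf{TC})$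 is a functor whose components on arrows and on objects are morphisms of $\mathsf{TC}$. It is a *covering morphism* if for every $x\in H_0$ the restriction $\{h\in H: d_0(h)=x\}\to\{g\in G: d_0(g)=f(x)\}$ is a homeomorphism. The category $\mathrm{Cov}_{\mathrm{Cat}(\mathsf{TC})}/G$ has the covering morphisms $p\colon\widetilde G\to G$ as objects; a morphism from $p$ to $q\colon\widetilde H\to G$ is a morphism $f\colon\widetilde G\to\widetilde H$ in $\mathrm{Cat}(\mathsf{TC})$ with $qf=p$. *Crossed modules.* A continuous derived action of $B$ on $A$ in $\mathsf{TC}$ consists of continuous maps $B\times A\to A$, $(b,a)\mapsto b\cdot a$ and $(b,a)\mapsto b\star a$ ($\star\in\Omega_2'$), arising from a split extension $0\to A\to E\xrightarrow{\,p\,}B\to0$ in $\mathsf{TC}$ ($A\to E$ the kernel of $p$ with the subspace topology) with section $s$ by $b\cdot a=s(b)+a-s(b)$, $b\star a=s(b)\star a$; we write $a\star b$ for $b\star^{\circ}a$. A crossed module in $\mathsf{TC}$ is a morphism $\alpha\colon A\to B$ of $\mathsf{TC}$ with a continuous derived action of $B$ on $A$ such that $\alpha(b\cdot a)=b+\alpha(a)-b$,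 $\alpha(a)\cdot a'=a+a'-a$, $\alpha(a)\star a'=a\star a'$, $\alpha(b\star a)=b\star\alpha(a)$ and $\alpha(a\star b)=\alpha(a)\star b$ for all $a,a'\in A$, $b\in B$, $\star\in\Omega_2'$. A morphism $(f_1,f_2)\colon(\alpha\colon A\to B)\to(\alpha'\colon A'\to B')$ in $\mathrm{XMod}(\mathsf{TC})$ consists of morphisms $f_1\colon A\to A'$, $f_2\colon B\to B'$ of $\mathsf{TC}$ with $f_2\alpha=\alpha'f_1$, $f_1(b\cdot a)=f_2(b)\cdot f_1(a)$ and $f_1(b\star a)=f_2(b)\star f_1(a)$. It is a *cover* if $f_1$ is an isomorphism in $\mathsf{TC}$. The category $\mathrm{Cov}_{\mathrm{XMod}(\mathsf{TC})}/\alpha$ has the covers with target $\alpha$ as objects and the morphisms of $\mathrm{XMod}(\mathsf{TC})$ over $\alpha$ as morphisms. **Theorem.** Let $G$ be an internal groupoid in $\mathsf{TC}$ and let $\alpha\colon A\to B$ be the corresponding crossed module, that is, $A=\ker d_0$, $B=G_0$, $\alpha=d_1|_{A}$, with $b\cdot a=\varepsilon(b)+a-\varepsilon(b)$ and $b\star a=\varepsilon(b)\star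 a$. Then the categories $\mathrm{Cov}_{\mathrm{Cat}(\mathsf{TC})}/G$ and $\mathrm{Cov}_{\mathrm{XMod}(\mathsf{TC})}/(\alpha\colon A\to B)$ are equivalent. -/

import Mathlib

open CategoryTheory

universe u v w

namespace TopOps

/-! ## Categories of topological groups with operations -/

/-- Terms in countably many variables built from `0`, `-`, `+`, unary operation symbols `Ω₁`
and binary operation symbols `Ω₂`. -/
inductive OpTerm (Ω₁ : Type v) (Ω₂ : Type w) : Type (max v w)
  | var : ℕ → OpTerm Ω₁ Ω₂
  | zero : OpTerm Ω₁ Ω₂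
  | neg : OpTerm Ω₁ Ω₂ → OpTerm Ω₁ Ω₂
  | add : OpTerm Ω₁ Ω₂ → OpTerm Ω₁ Ω₂ → OpTerm Ω₁ Ω₂
  | un : Ω₁ → OpTerm Ω₁ Ω₂ → OpTerm Ω₁ Ω₂
  | bin : Ω₂ → OpTerm Ω₁ Ω₂ → OpTerm Ω₁ Ω₂ → OpTerm Ω₁ Ω₂

/-- The value of a term in an additively written group with unary operations `un` and
binary operations `bin`, under an assignment of the variables. -/
def OpTerm.eval {Ω₁ : Type v} {Ω₂ : Type w} {X : Type u} [AddGroup X]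
    (un : Ω₁ → X → X) (bin : Ω₂ → X → X → X) (val : ℕ → X) : OpTerm Ω₁ Ω₂ → X
  | .var n => val n
  | .zero => 0
  | .neg t => -(t.eval un bin val)
  | .add t t' => t.eval un bin val + t'.eval un bin val
  | .un o t => un o (t.eval un bin val)
  | .bin o t t' => bin o (t.eval un bin val) (t'.eval un bin val)

theorem OpTerm.eval_map {Ω₁ : Type v} {Ω₂ : Type w} {X Y : Type*} [AddGroup X] [AddGroup Y]
    {un : Ω₁ → X → X} {bin : Ω₂ → X → X → X} {un' : Ω₁ → Y → Y} {bin' : Ω₂ → Y → Y → Y}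
    (f : X →+ Y) (hun : ∀ o x, f (un o x) = un' o (f x))
    (hbin : ∀ o x y, f (bin o x y) = bin' o (f x) (f y)) (val : ℕ → X) (t : OpTerm Ω₁ Ω₂) :
    f (t.eval un bin val) = t.eval un' bin' (fun n => f (val n)) := by
  induction t with
  | var n => rfl
  | zero => exact map_zero f
  | neg t ih => simp [OpTerm.eval, ih]
  | add t t' ih ih' => simp [OpTerm.eval, ih, ih']
  | un o t ih => simp [OpTerm.eval, ih, hun]
  | bin o t t' ih ih' => simp [OpTerm.eval, ih, ih', hbin]

/-- The data `(Ω, E)` that determine a category of (topological) groups with operations.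
`Ω₁` and `Ω₂` are the operation symbols other than `-` and `+`; the only constant is `0`.
For `⋆` in `Ω₂`, `flip ⋆` is the symbol of the opposite operation.  `E` holds the identities
that are imposed in addition to the obligatory ones (the group laws, the law that defines
`flip`, distributivity, additivity of `ω`, and `ω(a) ⋆ b = ω(a ⋆ b)`), which are required of
every object in `TopOpGroup`. -/
structure OpTheory where
  Ω₁ : Type v
  Ω₂ : Type w
  flip : Ω₂ → Ω₂
  E : Set (OpTerm Ω₁ Ω₂ × OpTerm Ω₁ Ω₂)

/-- A topological group with operations, i.e. an object of the category `TC` determined by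
`T`: a topological group (not necessarily commutative) with continuous operations that satisfy
the identities of the theory. -/
structure TopOpGroup (T : OpTheory.{v, w}) where
  carrier : Type u
  [addGroup : AddGroup carrier]
  [top : TopologicalSpace carrier]
  [topAddGroup : IsTopologicalAddGroup carrier]
  un : T.Ω₁ → carrier → carrier
  bin : T.Ω₂ → carrier → carrier → carrier
  continuous_un : ∀ o, Continuous (un o)
  continuous_bin : ∀ o, Continuous (fun p : carrier × carrier => bin o p.1 p.2)
  bin_flip : ∀ o a b, bin (T.flip o) a b = bin o b a
  bin_add : ∀ o a b c, bin o a (b + c) = bin o a b + bin o a c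
  un_add : ∀ o a b, un o (a + b) = un o a + un o b
  un_bin : ∀ o o' a b, bin o' (un o a) b = un o (bin o' a b)
  identities : ∀ e ∈ T.E, ∀ val : ℕ → carrier,
    OpTerm.eval un bin val e.1 = OpTerm.eval un bin val e.2

namespace TopOpGroup

variable {T : OpTheory.{v, w}}

instance : CoeSort (TopOpGroup.{u} T) (Type u) := ⟨carrier⟩

instance (X : TopOpGroup.{u} T) : AddGroup X := X.addGroup
instance (X : TopOpGroup.{u} T) : TopologicalSpace X := X.top
instance (X : TopOpGroup.{u} T) : IsTopologicalAddGroup X := X.topAddGroup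

/-- A morphism in `TC`: a continuous group homomorphism that preserves the operations. -/
@[ext] structure Hom (X Y : TopOpGroup.{u} T) where
  toFun : X → Y
  continuous_toFun : Continuous toFun
  map_add' : ∀ a b, toFun (a + b) = toFun a + toFun b
  map_un' : ∀ o a, toFun (X.un o a) = Y.un o (toFun a)
  map_bin' : ∀ o a b, toFun (X.bin o a b) = Y.bin o (toFun a) (toFun b)

instance (X Y : TopOpGroup.{u} T) : FunLike (Hom X Y) X Y where
  coe := Hom.toFun
  coe_injective _ _ h := Hom.ext h

instance (X Y : TopOpGroup.{u} T) : AddMonoidHomClass (Hom X Y) X Y where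
  map_add f := f.map_add'
  map_zero f := by
    have h : f.toFun (0 + 0) = f.toFun 0 + f.toFun 0 := f.map_add' 0 0
    rw [add_zero] at h
    exact left_eq_add.mp h

/-- The identity morphism. -/
def Hom.id (X : TopOpGroup.{u} T) : Hom X X :=
  ⟨fun x => x, continuous_id, fun _ _ => rfl, fun _ _ => rfl, fun _ _ _ => rfl⟩

/-- `f` followed by `g`. -/
def Hom.comp {X Y Z : TopOpGroup.{u} T} (f : Hom X Y) (g : Hom Y Z) : Hom X Z where
  toFun x := g.toFun (f.toFun x)
  continuous_toFun := g.continuous_toFun.comp f.continuous_toFun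
  map_add' a b := by rw [f.map_add', g.map_add']
  map_un' o a := by rw [f.map_un', g.map_un']
  map_bin' o a b := by rw [f.map_bin', g.map_bin']

/-- The category `TC`. -/
instance : Category (TopOpGroup.{u} T) where
  Hom := Hom
  id := Hom.id
  comp := Hom.comp

theorem bin_zero (X : TopOpGroup.{u} T) (o : T.Ω₂) (a : X) : X.bin o a 0 = 0 := by
  have h := X.bin_add o a 0 0
  rw [add_zero] at h
  exact left_eq_add.mp h

theorem zero_bin (X : TopOpGroup.{u} T) (o : T.Ω₂) (a : X) : X.bin o 0 a = 0 := by
  rw [← X.bin_flip, bin_zero]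

theorem add_bin (X : TopOpGroup.{u} T) (o : T.Ω₂) (a b c : X) :
    X.bin o (a + b) c = X.bin o a c + X.bin o b c := by
  rw [← X.bin_flip, X.bin_add, X.bin_flip, X.bin_flip]

theorem un_zero (X : TopOpGroup.{u} T) (o : T.Ω₁) : X.un o 0 = 0 := by
  have h := X.un_add o 0 0
  rw [add_zero] at h
  exact left_eq_add.mp h

/-- A subgroup closed under the operations, with the subspace topology. -/
def sub (X : TopOpGroup.{u} T) (S : AddSubgroup X) (hun : ∀ o, ∀ a ∈ S, X.un o a ∈ S)
    (hbin : ∀ o, ∀ a ∈ S, ∀ b ∈ S, X.bin o a b ∈ S) : TopOpGroup.{u} T where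
  carrier := S
  un o a := ⟨X.un o a, hun o a a.2⟩
  bin o a b := ⟨X.bin o a b, hbin o a a.2 b b.2⟩
  continuous_un o := ((X.continuous_un o).comp continuous_subtype_val).subtype_mk _
  continuous_bin o := ((X.continuous_bin o).comp
    (f := fun p : S × S => ((p.1 : X), (p.2 : X))) (by fun_prop)).subtype_mk _
  bin_flip o a b := Subtype.ext (X.bin_flip o a b)
  bin_add o a b c := Subtype.ext (X.bin_add o a b c)
  un_add o a b := Subtype.ext (X.un_add o a b)
  un_bin o o' a b := Subtype.ext (X.un_bin o o' a b)
  identities e he val := by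
    apply Subtype.ext
    have h := X.identities e he (fun n => (val n : X))
    have key := OpTerm.eval_map (un := fun o (a : S) => (⟨X.un o a, hun o a a.2⟩ : S))
      (bin := fun o (a b : S) => (⟨X.bin o a b, hbin o a a.2 b b.2⟩ : S))
      (un' := X.un) (bin' := X.bin) S.subtype (fun _ _ => rfl) (fun _ _ _ => rfl) val
    exact (key e.1).trans (h.trans (key e.2).symm)

/-- The product with the product topology and componentwise operations. -/
def prod (X Y : TopOpGroup.{u} T) : TopOpGroup.{u} T where
  carrier := X × Y
  un o a := (X.un o a.1, Y.un o a.2)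
  bin o a b := (X.bin o a.1 b.1, Y.bin o a.2 b.2)
  continuous_un o := ((X.continuous_un o).comp continuous_fst).prodMk
    ((Y.continuous_un o).comp continuous_snd)
  continuous_bin o :=
    ((X.continuous_bin o).comp (f := fun p : (X × Y) × (X × Y) => (p.1.1, p.2.1))
      (by fun_prop)).prodMk
    ((Y.continuous_bin o).comp (f := fun p : (X × Y) × (X × Y) => (p.1.2, p.2.2))
      (by fun_prop))
  bin_flip o a b := Prod.ext (X.bin_flip o _ _) (Y.bin_flip o _ _)
  bin_add o a b c := Prod.ext (X.bin_add o _ _ _) (Y.bin_add o _ _ _)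
  un_add o a b := Prod.ext (X.un_add o _ _) (Y.un_add o _ _)
  un_bin o o' a b := Prod.ext (X.un_bin o o' _ _) (Y.un_bin o o' _ _)
  identities e he val := by
    have k₁ := OpTerm.eval_map (un := fun o (a : X × Y) => (X.un o a.1, Y.un o a.2))
      (bin := fun o (a b : X × Y) => (X.bin o a.1 b.1, Y.bin o a.2 b.2))
      (un' := X.un) (bin' := X.bin) (AddMonoidHom.fst X Y) (fun _ _ => rfl)
      (fun _ _ _ => rfl) val
    have k₂ := OpTerm.eval_map (un := fun o (a : X × Y) => (X.un o a.1, Y.un o a.2))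
      (bin := fun o (a b : X × Y) => (X.bin o a.1 b.1, Y.bin o a.2 b.2))
      (un' := Y.un) (bin' := Y.bin) (AddMonoidHom.snd X Y) (fun _ _ => rfl)
      (fun _ _ _ => rfl) val
    exact Prod.ext ((k₁ e.1).trans ((X.identities e he _).trans (k₁ e.2).symm))
      ((k₂ e.1).trans ((Y.identities e he _).trans (k₂ e.2).symm))

/-- The kernel of a morphism of `TC`, with the subspace topology. -/
def ker {X Y : TopOpGroup.{u} T} (f : Hom X Y) : TopOpGroup.{u} T :=
  X.sub (AddMonoidHom.ker (f : X →+ Y))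
    (fun o a (ha : f.toFun a = 0) => show f.toFun _ = 0 by rw [f.map_un', ha, un_zero])
    (fun o a (ha : f.toFun a = 0) b (_ : f.toFun b = 0) =>
      show f.toFun _ = 0 by rw [f.map_bin', ha, zero_bin])

/-- The inclusion of the kernel. -/
def kerι {X Y : TopOpGroup.{u} T} (f : Hom X Y) : Hom (ker f) X :=
  ⟨Subtype.val, continuous_subtype_val, fun _ _ => rfl, fun _ _ => rfl, fun _ _ _ => rfl⟩

/-- The pullback `{(x, y) | f x = g y}` of two morphisms of `TC`, a subobject of the product. -/
def pullback {X Y Z : TopOpGroup.{u} T} (f : Hom X Z) (g : Hom Y Z) : TopOpGroup.{u} T :=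
  (X.prod Y).sub
    { carrier := {q : X × Y | f q.1 = g q.2}
      zero_mem' := (map_zero f).trans (map_zero g).symm
      add_mem' := fun {a b} (ha : f a.1 = g a.2) (hb : f b.1 = g b.2) =>
        show f (a.1 + b.1) = g (a.2 + b.2) by rw [map_add, map_add, ha, hb]
      neg_mem' := fun {a} (ha : f a.1 = g a.2) =>
        show f (-a.1) = g (-a.2) by rw [map_neg, map_neg, ha] }
    (fun o a (ha : f.toFun a.1 = g.toFun a.2) =>
      show f.toFun (X.un o a.1) = g.toFun (Y.un o a.2) by rw [f.map_un', g.map_un', ha])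
    (fun o a (ha : f.toFun a.1 = g.toFun a.2) b (hb : f.toFun b.1 = g.toFun b.2) =>
      show f.toFun (X.bin o a.1 b.1) = g.toFun (Y.bin o a.2 b.2) by
        rw [f.map_bin', g.map_bin', ha, hb])

/-- The element of the pullback given by a compatible pair. -/
def pullback.mk {X Y Z : TopOpGroup.{u} T} {f : Hom X Z} {g : Hom Y Z} (x : X) (y : Y)
    (h : f x = g y) : pullback f g := ⟨(x, y), h⟩

end TopOpGroup

open TopOpGroup

variable {T : OpTheory.{v, w}}

/-! ## Internal groupoids in `TC` and their covering morphisms -/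

/-- An internal category in `TC`: the initial and final point maps, the object inclusion and
the partial composition (`comp` of `(a, b)` is `a ∘ b`, defined when `d₁ a = d₀ b`) are
morphisms of `TC`.  It is automatically a groupoid, see `InternalGroupoid.exists_inverse`. -/
structure InternalGroupoid (T : OpTheory.{v, w}) where
  arr : TopOpGroup.{u} T
  obj : TopOpGroup.{u} T
  d₀ : Hom arr obj
  d₁ : Hom arr obj
  ε : Hom obj arr
  comp : Hom (pullback d₁ d₀) arr
  d₀_ε : ∀ x, d₀ (ε x) = x
  d₁_ε : ∀ x, d₁ (ε x) = x
  d₀_comp : ∀ a b (h : d₁ a = d₀ b), d₀ (comp (pullback.mk a b h)) = d₀ a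
  d₁_comp : ∀ a b (h : d₁ a = d₀ b), d₁ (comp (pullback.mk a b h)) = d₁ b
  id_comp : ∀ a, comp (pullback.mk (ε (d₀ a)) a (d₁_ε _)) = a
  comp_id : ∀ a, comp (pullback.mk a (ε (d₁ a)) (d₀_ε _).symm) = a
  assoc : ∀ a b c (h : d₁ a = d₀ b) (h' : d₁ b = d₀ c),
    comp (pullback.mk (comp (pullback.mk a b h)) c ((d₁_comp a b h).trans h')) =
      comp (pullback.mk a (comp (pullback.mk b c h')) (h.trans (d₀_comp b c h').symm))

namespace InternalGroupoid

/-- A morphism in `Cat(TC)`: a morphism of the underlying groupoids whose components are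
morphisms in `TC`. -/
@[ext] structure Hom (H G : InternalGroupoid.{u} T) where
  onArr : TopOpGroup.Hom H.arr G.arr
  onObj : TopOpGroup.Hom H.obj G.obj
  map_d₀ : ∀ a, G.d₀ (onArr a) = onObj (H.d₀ a)
  map_d₁ : ∀ a, G.d₁ (onArr a) = onObj (H.d₁ a)
  map_ε : ∀ x, onArr (H.ε x) = G.ε (onObj x)
  map_comp : ∀ a b (h : H.d₁ a = H.d₀ b),
    onArr (H.comp (pullback.mk a b h)) = G.comp (pullback.mk (onArr a) (onArr b)
      ((map_d₁ a).trans ((congrArg onObj h).trans (map_d₀ b).symm)))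

/-- The category `Cat(TC)` of internal groupoids in `TC`. -/
instance : Category (InternalGroupoid.{u} T) where
  Hom := Hom
  id G := ⟨TopOpGroup.Hom.id _, TopOpGroup.Hom.id _, fun _ => rfl, fun _ => rfl, fun _ => rfl,
    fun _ _ _ => rfl⟩
  comp {X Y Z} f g :=
    { onArr := f.onArr.comp g.onArr
      onObj := f.onObj.comp g.onObj
      map_d₀ := fun a => (g.map_d₀ (f.onArr a)).trans (congrArg g.onObj (f.map_d₀ a))
      map_d₁ := fun a => (g.map_d₁ (f.onArr a)).trans (congrArg g.onObj (f.map_d₁ a))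
      map_ε := fun x => (congrArg g.onArr (f.map_ε x)).trans (g.map_ε (f.onObj x))
      map_comp := fun a b h => (congrArg g.onArr (f.map_comp a b h)).trans
        (g.map_comp (f.onArr a) (f.onArr b) _) }

/-- The star of `x`, the space of all arrows with initial point `x`. -/
abbrev Star (G : InternalGroupoid.{u} T) (x : G.obj) : Type u := {a : G.arr // G.d₀ a = x}

/-- The restriction of a morphism to a star. -/
def Hom.starMap {H G : InternalGroupoid.{u} T} (f : Hom H G) (x : H.obj) :
    H.Star x → G.Star (f.onObj x) :=
  fun a => ⟨f.onArr a.1, (f.map_d₀ a.1).trans (congrArg f.onObj a.2)⟩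

/-- A covering morphism in `Cat(TC)`: on each star the restriction is an isomorphism of
topological spaces onto the star of the image point. -/
def Hom.IsCovering {H G : InternalGroupoid.{u} T} (f : Hom H G) : Prop :=
  ∀ x : H.obj, IsHomeomorph (f.starMap x)

/-- The category of covering morphisms over `G` in `Cat(TC)`: objects are the covering morphisms
`p` into `G`, morphisms from `p` to `q` are the morphisms `f` of `Cat(TC)` with `q f = p`. -/
abbrev Cov (G : InternalGroupoid.{u} T) :=
  ObjectProperty.FullSubcategory (C := Over G) (fun p => Hom.IsCovering p.hom)

variable (G : InternalGroupoid.{u} T)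

/-- The interchange law for `+`. -/
theorem comp_add (a b a' b' : G.arr) (h : G.d₁ a = G.d₀ b) (h' : G.d₁ a' = G.d₀ b') :
    G.comp (pullback.mk a b h) + G.comp (pullback.mk a' b' h') =
      G.comp (pullback.mk (a + a') (b + b') (by rw [map_add, map_add, h, h'])) :=
  (map_add G.comp (pullback.mk a b h) (pullback.mk a' b' h')).symm

/-- The interchange law for the operations in `Ω₂`. -/
theorem comp_bin (o : T.Ω₂) (a b a' b' : G.arr) (h : G.d₁ a = G.d₀ b)
    (h' : G.d₁ a' = G.d₀ b') :
    G.arr.bin o (G.comp (pullback.mk a b h)) (G.comp (pullback.mk a' b' h')) =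
      G.comp (pullback.mk (G.arr.bin o a a') (G.arr.bin o b b')
        ((G.d₁.map_bin' o a a').trans ((congrArg₂ (G.obj.bin o) h h').trans
          (G.d₀.map_bin' o b b').symm))) :=
  (G.comp.map_bin' o (pullback.mk a b h) (pullback.mk a' b' h')).symm

theorem comp_congr {a b a' b' : G.arr} (ha : a = a') (hb : b = b') (h : G.d₁ a = G.d₀ b)
    (h' : G.d₁ a' = G.d₀ b') :
    G.comp (pullback.mk a b h) = G.comp (pullback.mk a' b' h') := by
  subst ha hb; rfl

theorem comp_zero (x : G.arr) (hx : G.d₁ x = 0) :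
    G.comp (pullback.mk x 0 (by rw [hx, map_zero])) = x :=
  (G.comp_congr rfl (by rw [hx, map_zero]) _ _).trans (G.comp_id x)

theorem zero_comp (y : G.arr) (hy : G.d₀ y = 0) :
    G.comp (pullback.mk 0 y (by rw [hy, map_zero])) = y :=
  (G.comp_congr (by rw [hy, map_zero]) rfl _ _).trans (G.id_comp y)

/-- The composition is determined by the group structure. -/
theorem comp_eq (a b : G.arr) (h : G.d₁ a = G.d₀ b) :
    G.comp (pullback.mk a b h) = b - G.ε (G.d₀ b) + a := by
  have hy : G.d₀ (b - G.ε (G.d₀ b)) = 0 := by rw [map_sub, G.d₀_ε, sub_self]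
  conv_rhs => rw [← G.zero_comp _ hy, ← G.comp_id a, comp_add]
  exact G.comp_congr (by simp) (by rw [h]; simp) _ _

/-- Elements of the kernels of `d₁` and of `d₀` commute. -/
theorem ker_add_comm (x y : G.arr) (hx : G.d₁ x = 0) (hy : G.d₀ y = 0) : x + y = y + x := by
  conv_lhs => rw [← G.comp_zero x hx, ← G.zero_comp y hy, comp_add]
  conv_rhs => rw [← G.comp_zero x hx, ← G.zero_comp y hy, comp_add]
  exact G.comp_congr (by simp) (by simp) _ _

/-- Elements of the kernels of `d₁` and of `d₀` have zero products. -/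
theorem ker_bin (o : T.Ω₂) (x y : G.arr) (hx : G.d₁ x = 0) (hy : G.d₀ y = 0) :
    G.arr.bin o x y = 0 := by
  conv_lhs => rw [← G.comp_zero x hx, ← G.zero_comp y hy, comp_bin]
  rw [G.comp_congr (bin_zero _ _ _) (zero_bin _ _ _) _ ((map_zero G.d₁).trans (map_zero G.d₀).symm),
    G.comp_zero 0 (map_zero _)]

/-- Every arrow of an internal category in `TC` is invertible. -/
theorem exists_inverse (a : G.arr) : ∃ (b : G.arr) (h : G.d₁ a = G.d₀ b)
    (h' : G.d₁ b = G.d₀ a), G.comp (pullback.mk a b h) = G.ε (G.d₀ a) ∧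
      G.comp (pullback.mk b a h') = G.ε (G.d₁ a) := by
  refine ⟨G.ε (G.d₁ a) - a + G.ε (G.d₀ a), ?_, ?_, ?_, ?_⟩
  · rw [map_add, map_sub, G.d₀_ε, G.d₀_ε]; simp
  · rw [map_add, map_sub, G.d₁_ε, G.d₁_ε]; simp
  · rw [comp_eq, map_add, map_sub, G.d₀_ε, G.d₀_ε, sub_add_cancel]
    have h := G.ker_add_comm (-G.ε (G.d₁ a) + a) (-a + G.ε (G.d₀ a))
      (by rw [map_add, map_neg, G.d₁_ε]; simp) (by rw [map_add, map_neg, G.d₀_ε]; simp)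
    calc G.ε (G.d₁ a) - a + G.ε (G.d₀ a) - G.ε (G.d₁ a) + a
        = G.ε (G.d₁ a) + ((-a + G.ε (G.d₀ a)) + (-G.ε (G.d₁ a) + a)) := by
          simp only [sub_eq_add_neg, add_assoc]
      _ = G.ε (G.d₀ a) := by rw [← h]; simp only [add_assoc, add_neg_cancel_left]
  · have h := G.ker_add_comm (G.ε (G.d₁ a) - a) (a - G.ε (G.d₀ a))
      (by rw [map_sub, G.d₁_ε, sub_self]) (by rw [map_sub, G.d₀_ε, sub_self])
    rw [comp_eq, ← add_assoc, ← h]; simp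

end InternalGroupoid

/-! ## Crossed modules in `TC` and their covers -/

/-- A split extension of `B` by `A` in `TC`: an exact sequence `0 → A → E → B → 0` in which
`i : A → E` is the kernel of `p : E → B` in `TC` (so `A` carries the subspace topology), with
a section `s` of `p` in `TC`. -/
structure SplitExtension (A B : TopOpGroup.{u} T) where
  E : TopOpGroup.{u} T
  i : TopOpGroup.Hom A E
  p : TopOpGroup.Hom E B
  s : TopOpGroup.Hom B E
  isEmbedding_i : Topology.IsEmbedding i
  exact : ∀ e, p e = 0 ↔ ∃ a, i a = e
  p_s : ∀ b, p (s b) = b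

/-- A continuous derived action of `B` on `A` in `TC`: continuous maps `(b, a) ↦ b · a` and
`(b, a) ↦ b ⋆ a` (one for each `⋆` in `Ω₂`) that are induced by some split extension of `B` by
`A` in `TC`, i.e. `b · a = s(b) + a - s(b)` and `b ⋆ a = s(b) ⋆ a`.
The element `a ⋆ b` of `A` is `b ⋆° a`, where `⋆°` is the opposite operation of `⋆`. -/
@[ext] structure DerivedAction (A B : TopOpGroup.{u} T) where
  dot : B → A → A
  star : T.Ω₂ → B → A → A
  continuous_dot : Continuous (fun q : B × A => dot q.1 q.2)
  continuous_star : ∀ o, Continuous (fun q : B × A => star o q.1 q.2)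
  derived : ∃ S : SplitExtension A B,
    (∀ b a, S.i (dot b a) = S.s b + S.i a - S.s b) ∧
    (∀ o b a, S.i (star o b a) = S.E.bin o (S.s b) (S.i a))

/-- A crossed module `α : A → B` in `TC`. -/
structure CrossedModule (T : OpTheory.{v, w}) where
  A : TopOpGroup.{u} T
  B : TopOpGroup.{u} T
  α : TopOpGroup.Hom A B
  act : DerivedAction A B
  cm1 : ∀ b a, α (act.dot b a) = b + α a - b
  cm2 : ∀ a a', act.dot (α a) a' = a + a' - a
  cm3 : ∀ o a a', act.star o (α a) a' = A.bin o a a'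
  cm4_left : ∀ o b a, α (act.star o b a) = B.bin o b (α a)
  cm4_right : ∀ o b a, α (act.star (T.flip o) b a) = B.bin o (α a) b

namespace CrossedModule

/-- A morphism of crossed modules in `TC`. -/
@[ext] structure Hom (M N : CrossedModule.{u} T) where
  f₁ : TopOpGroup.Hom M.A N.A
  f₂ : TopOpGroup.Hom M.B N.B
  comm : ∀ a, f₂ (M.α a) = N.α (f₁ a)
  map_dot : ∀ b a, f₁ (M.act.dot b a) = N.act.dot (f₂ b) (f₁ a)
  map_star : ∀ o b a, f₁ (M.act.star o b a) = N.act.star o (f₂ b) (f₁ a)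

/-- The category `XMod(TC)` of crossed modules in `TC`. -/
instance : Category (CrossedModule.{u} T) where
  Hom := Hom
  id M := ⟨TopOpGroup.Hom.id _, TopOpGroup.Hom.id _, fun _ => rfl, fun _ _ => rfl,
    fun _ _ _ => rfl⟩
  comp {X Y Z} f g :=
    { f₁ := f.f₁.comp g.f₁
      f₂ := f.f₂.comp g.f₂
      comm := fun a => (congrArg g.f₂ (f.comm a)).trans (g.comm (f.f₁ a))
      map_dot := fun b a => (congrArg g.f₁ (f.map_dot b a)).trans (g.map_dot _ _)
      map_star := fun o b a => (congrArg g.f₁ (f.map_star o b a)).trans (g.map_star _ _ _) }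

/-- A morphism `(f₁, f₂)` of crossed modules is a cover if `f₁` is an isomorphism in `TC`. -/
def Hom.IsCover {M N : CrossedModule.{u} T} (f : Hom M N) : Prop :=
  IsIso (show M.A ⟶ N.A from f.f₁)

/-- The category of covers of the crossed module `M` in `TC`: objects are the covers `p` with
target `M`, morphisms from `p` to `q` are the morphisms `f` of `XMod(TC)` with `q f = p`. -/
abbrev Cov (M : CrossedModule.{u} T) :=
  ObjectProperty.FullSubcategory (C := Over M) (fun p => Hom.IsCover p.hom)

end CrossedModule

namespace InternalGroupoid

/-- The action of `G₀` on `Ker d₀` given by `b · a = ε(b) + a - ε(b)` and `b ⋆ a = ε(b) ⋆ a`. -/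
def action (G : InternalGroupoid.{u} T) : DerivedAction (ker G.d₀) G.obj where
  dot b a := ⟨G.ε b + a.1 - G.ε b,
    show G.d₀ _ = 0 by
      rw [map_sub, map_add, show G.d₀ a.1 = 0 from a.2, add_zero, sub_self]⟩
  star o b a := ⟨G.arr.bin o (G.ε b) a.1,
    show G.d₀.toFun _ = 0 by
      rw [G.d₀.map_bin', show G.d₀.toFun a.1 = 0 from a.2, bin_zero]⟩
  continuous_dot := by
    have hε : Continuous (fun q : G.obj × ker G.d₀ => G.ε q.1) :=
      G.ε.continuous_toFun.comp continuous_fst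
    have ha : Continuous (fun q : G.obj × ker G.d₀ => (q.2.1 : G.arr)) :=
      continuous_subtype_val.comp continuous_snd
    exact ((hε.add ha).sub hε).subtype_mk _
  continuous_star o := by
    have hε : Continuous (fun q : G.obj × ker G.d₀ => G.ε q.1) :=
      G.ε.continuous_toFun.comp continuous_fst
    have ha : Continuous (fun q : G.obj × ker G.d₀ => (q.2.1 : G.arr)) :=
      continuous_subtype_val.comp continuous_snd
    exact ((G.arr.continuous_bin o).comp (hε.prodMk ha)).subtype_mk _
  derived := ⟨
    { E := G.arr
      i := kerι G.d₀
      p := G.d₀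
      s := G.ε
      isEmbedding_i := Topology.IsEmbedding.subtypeVal
      exact := fun e => ⟨fun h => ⟨⟨e, h⟩, rfl⟩, fun ⟨a, h⟩ => h ▸ a.2⟩
      p_s := G.d₀_ε }, fun _ _ => rfl, fun _ _ _ => rfl⟩

/-- The crossed module `d₁ : Ker d₀ → G₀` that corresponds to the internal groupoid `G`. -/
def toCrossedModule (G : InternalGroupoid.{u} T) : CrossedModule.{u} T where
  A := ker G.d₀
  B := G.obj
  α := (kerι G.d₀).comp G.d₁
  act := G.action
  cm1 b a := show G.d₁ (G.ε b + a.1 - G.ε b) = b + G.d₁ a.1 - b by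
    rw [map_sub, map_add, G.d₁_ε]
  cm2 a a' := Subtype.ext <| show G.ε (G.d₁ a.1) + a'.1 - G.ε (G.d₁ a.1) = a.1 + a'.1 - a.1 by
    have h := G.ker_add_comm (-a.1 + G.ε (G.d₁ a.1)) a'.1
      (by rw [map_add, map_neg, G.d₁_ε, neg_add_cancel]) a'.2
    calc G.ε (G.d₁ a.1) + a'.1 - G.ε (G.d₁ a.1)
        = a.1 + ((-a.1 + G.ε (G.d₁ a.1)) + a'.1) - G.ε (G.d₁ a.1) := by
          simp only [add_assoc, add_neg_cancel_left]
      _ = a.1 + a'.1 - a.1 := by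
          rw [h]; simp only [sub_eq_add_neg, add_assoc, add_neg_cancel, add_zero]
  cm3 o a a' := Subtype.ext <| show G.arr.bin o (G.ε (G.d₁ a.1)) a'.1 = G.arr.bin o a.1 a'.1 by
    have h := G.ker_bin o (-a.1 + G.ε (G.d₁ a.1)) a'.1
      (by rw [map_add, map_neg, G.d₁_ε, neg_add_cancel]) a'.2
    calc G.arr.bin o (G.ε (G.d₁ a.1)) a'.1
        = G.arr.bin o (a.1 + (-a.1 + G.ε (G.d₁ a.1))) a'.1 := by rw [add_neg_cancel_left]
      _ = G.arr.bin o a.1 a'.1 := by rw [add_bin, h, add_zero]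
  cm4_left o b a := show G.d₁.toFun (G.arr.bin o (G.ε b) a.1) = G.obj.bin o b (G.d₁ a.1) by
    rw [G.d₁.map_bin', show G.d₁.toFun (G.ε b) = b from G.d₁_ε b]; rfl
  cm4_right o b a := show G.d₁.toFun (G.arr.bin (T.flip o) (G.ε b) a.1) =
      G.obj.bin o (G.d₁ a.1) b by
    rw [G.d₁.map_bin', show G.d₁.toFun (G.ε b) = b from G.d₁_ε b, bin_flip]; rfl

end InternalGroupoid

end TopOps

namespace TopOps

open CategoryTheory TopOpGroup Topology

namespace TopOpGroup

variable {T : OpTheory.{v, w}}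

theorem isIso_of_isHomeomorph {X Y : TopOpGroup.{u} T} (f : Hom X Y) (hf : IsHomeomorph f) :
    IsIso (show X ⟶ Y from f) := by
  let e := hf.homeomorph
  have he : ∀ x, f (e.symm x) = x := e.apply_symm_apply
  have hs : ∀ x, e.symm (f x) = x := e.symm_apply_apply
  let g : Hom Y X :=
    { toFun := e.symm
      continuous_toFun := e.symm.continuous
      map_add' := fun a b => hf.injective (by rw [he, map_add, he, he])
      map_un' := fun o a => hf.injective
        ((he _).trans (((f.map_un' o _).trans (congrArg (Y.un o) (he a))).symm))
      map_bin' := fun o a b => hf.injective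
        ((he _).trans (((f.map_bin' o _ _).trans (congrArg₂ (Y.bin o) (he a) (he b))).symm)) }
  exact ⟨g, Hom.ext (funext hs), Hom.ext (funext he)⟩

theorem isHomeomorph_of_isIso {X Y : TopOpGroup.{u} T} (f : Hom X Y)
    [h : IsIso (show X ⟶ Y from f)] : IsHomeomorph f := by
  let g : Hom Y X := inv (show X ⟶ Y from f)
  have hl : ∀ x, g (f x) = x := fun x =>
    congrFun (congrArg Hom.toFun (IsIso.hom_inv_id (show X ⟶ Y from f))) x
  have hr : ∀ y, f (g y) = y := fun y =>
    congrFun (congrArg Hom.toFun (IsIso.inv_hom_id (show X ⟶ Y from f))) y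
  exact (Homeomorph.mk ⟨f, g, hl, hr⟩ f.continuous_toFun g.continuous_toFun).isHomeomorph

theorem isIso_iff_isHomeomorph {X Y : TopOpGroup.{u} T} (f : Hom X Y) :
    IsIso (show X ⟶ Y from f) ↔ IsHomeomorph f :=
  ⟨fun _ => isHomeomorph_of_isIso f, isIso_of_isHomeomorph f⟩

theorem Hom.map_un {X Y : TopOpGroup.{u} T} (f : Hom X Y) (o : T.Ω₁) (a : X) :
    f (X.un o a) = Y.un o (f a) := f.map_un' o a

theorem Hom.map_bin {X Y : TopOpGroup.{u} T} (f : Hom X Y) (o : T.Ω₂) (a b : X) :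
    f (X.bin o a b) = Y.bin o (f a) (f b) := f.map_bin' o a b

theorem Hom.continuous {X Y : TopOpGroup.{u} T} (f : Hom X Y) : Continuous f :=
  f.continuous_toFun

end TopOpGroup

variable {T : OpTheory.{v, w}}

namespace SplitExtension

variable {A B : TopOpGroup.{u} T} (S : SplitExtension A B)

theorem i_injective : Function.Injective S.i := S.isEmbedding_i.injective

theorem p_i (a : A) : S.p (S.i a) = 0 := (S.exact _).2 ⟨a, rfl⟩

theorem exists_i_eq (e : S.E) : ∃ a, S.i a = e - S.s (S.p e) :=
  (S.exact _).1 (by rw [map_sub, S.p_s, sub_self])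

/-- The kernel component of an element of a split extension. -/
noncomputable def retr (e : S.E) : A := (S.exists_i_eq e).choose

theorem i_retr (e : S.E) : S.i (S.retr e) = e - S.s (S.p e) := (S.exists_i_eq e).choose_spec

theorem retr_eq {e : S.E} {a : A} (h : S.i a = e - S.s (S.p e)) : S.retr e = a :=
  S.i_injective ((S.i_retr e).trans h.symm)

theorem i_retr_add (e : S.E) : S.i (S.retr e) + S.s (S.p e) = e := by
  rw [i_retr, sub_add_cancel]

theorem i_retr_of_p_eq_zero {e : S.E} (h : S.p e = 0) : S.i (S.retr e) = e := by
  rw [i_retr, h, map_zero, sub_zero]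

theorem retr_i (a : A) : S.retr (S.i a) = a := S.retr_eq (by simp [p_i])

theorem retr_s (b : B) : S.retr (S.s b) = 0 := S.retr_eq (by simp [S.p_s])

theorem continuous_retr : Continuous S.retr := by
  rw [S.isEmbedding_i.continuous_iff]
  have h : S.i ∘ S.retr = fun e => e - S.s (S.p e) := funext S.i_retr
  rw [h]
  exact continuous_id.sub (S.s.continuous.comp S.p.continuous)

theorem p_conj (b : B) (a : A) : S.p (S.s b + S.i a - S.s b) = 0 := by
  simp [p_i]

/-- The universal property of a split extension: compatible morphisms on the kernel and on the
quotient extend to the total object. -/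
noncomputable def lift {X : TopOpGroup.{u} T} (f₁ : Hom A X) (f₂ : Hom B X)
    (hdot : ∀ b a c, S.i c = S.s b + S.i a - S.s b → f₁ c = f₂ b + f₁ a - f₂ b)
    (hstar : ∀ o b a c, S.i c = S.E.bin o (S.s b) (S.i a) → f₁ c = X.bin o (f₂ b) (f₁ a)) :
    Hom S.E X where
  toFun e := f₁ (S.retr e) + f₂ (S.p e)
  continuous_toFun := (f₁.continuous.comp S.continuous_retr).add (f₂.continuous.comp S.p.continuous)
  map_add' x y := by
    obtain ⟨c, hc⟩ := (S.exact _).1 (S.p_conj (S.p x) (S.retr y))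
    have h : S.retr (x + y) = S.retr x + c := S.retr_eq (by
      rw [map_add, hc, i_retr, i_retr, map_add, map_add]
      simp only [sub_eq_add_neg, add_assoc, neg_add_rev, neg_add_cancel_left])
    rw [h, map_add, hdot _ _ _ hc, map_add, map_add]
    simp only [sub_eq_add_neg, add_assoc, neg_add_cancel_left]
  map_un' o x := by
    have h : S.retr (S.E.un o x) = A.un o (S.retr x) := S.retr_eq (by
      rw [eq_sub_iff_add_eq, Hom.map_un, Hom.map_un, Hom.map_un, ← S.E.un_add, i_retr_add])
    rw [h, Hom.map_un, Hom.map_un, Hom.map_un, X.un_add]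
  map_bin' o x y := by
    obtain ⟨c, hc⟩ := (S.exact (S.E.bin o (S.s (S.p x)) (S.i (S.retr y)))).1
      (by rw [Hom.map_bin, p_i, bin_zero])
    obtain ⟨d, hd⟩ := (S.exact (S.E.bin (T.flip o) (S.s (S.p y)) (S.i (S.retr x)))).1
      (by rw [Hom.map_bin, p_i, bin_zero])
    have h : S.retr (S.E.bin o x y) = A.bin o (S.retr x) (S.retr y) + c + d := S.retr_eq (by
      rw [eq_sub_iff_add_eq]
      conv_rhs => rw [← S.i_retr_add x, ← S.i_retr_add y, S.E.bin_add, add_bin, add_bin]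
      rw [map_add, map_add, hc, hd, bin_flip]
      simp only [Hom.map_bin, add_assoc])
    rw [h, map_add, map_add, hstar _ _ _ _ hc, hstar _ _ _ _ hd, bin_flip, X.bin_add, add_bin,
      add_bin]
    simp only [Hom.map_bin, add_assoc]

section lift

variable {X : TopOpGroup.{u} T} (f₁ : Hom A X) (f₂ : Hom B X)
    (hdot : ∀ b a c, S.i c = S.s b + S.i a - S.s b → f₁ c = f₂ b + f₁ a - f₂ b)
    (hstar : ∀ o b a c, S.i c = S.E.bin o (S.s b) (S.i a) → f₁ c = X.bin o (f₂ b) (f₁ a))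

theorem lift_apply (e : S.E) : S.lift f₁ f₂ hdot hstar e = f₁ (S.retr e) + f₂ (S.p e) := rfl

theorem lift_i (a : A) : S.lift f₁ f₂ hdot hstar (S.i a) = f₁ a := by
  rw [lift_apply, retr_i, p_i, map_zero, add_zero]

theorem lift_s (b : B) : S.lift f₁ f₂ hdot hstar (S.s b) = f₂ b := by
  rw [lift_apply, retr_s, S.p_s, map_zero, zero_add]

end lift

end SplitExtension

namespace CrossedModule

variable (N : CrossedModule.{u} T)

/-- A split extension that induces the action of a crossed module. -/
noncomputable def ext : SplitExtension N.A N.B := N.act.derived.choose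

theorem i_dot (b : N.B) (a : N.A) :
    N.ext.i (N.act.dot b a) = N.ext.s b + N.ext.i a - N.ext.s b :=
  N.act.derived.choose_spec.1 b a

theorem i_star (o : T.Ω₂) (b : N.B) (a : N.A) :
    N.ext.i (N.act.star o b a) = N.ext.E.bin o (N.ext.s b) (N.ext.i a) :=
  N.act.derived.choose_spec.2 o b a

/-- The final point map of the internal groupoid of a crossed module. -/
noncomputable def target : TopOpGroup.Hom N.ext.E N.B :=
  N.ext.lift N.α (TopOpGroup.Hom.id _)
    (fun b a c h => by
      rw [← i_dot] at h
      rw [N.ext.i_injective h]; exact N.cm1 b a)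
    (fun o b a c h => by
      rw [← i_star] at h
      rw [N.ext.i_injective h]; exact N.cm4_left o b a)

theorem target_apply (e : N.ext.E) : N.target e = N.α (N.ext.retr e) + N.ext.p e := rfl

theorem target_i (a : N.A) : N.target (N.ext.i a) = N.α a := N.ext.lift_i ..

theorem target_s (b : N.B) : N.target (N.ext.s b) = b := N.ext.lift_s ..

/-- Conjugation of the kernel by an arrow depends only on its final point. -/
theorem conj_target (x : N.ext.E) (a : N.A) :
    N.ext.s (N.target x) + N.ext.i a - N.ext.s (N.target x) = x + N.ext.i a - x := by
  have key : ∀ c : N.A, N.ext.s (N.α c) + N.ext.i (N.act.dot (N.ext.p x) a) - N.ext.s (N.α c) =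
      N.ext.i c + N.ext.i (N.act.dot (N.ext.p x) a) - N.ext.i c := fun c => by
    rw [← i_dot, N.cm2, map_sub, map_add]
  have h := key (N.ext.retr x)
  rw [i_dot] at h
  conv_rhs => rw [← N.ext.i_retr_add x]
  rw [target_apply, map_add]
  simpa only [sub_eq_add_neg, add_assoc, neg_add_rev] using h

/-- Products of arrows with elements of the kernel depend only on the final point. -/
theorem bin_target (o : T.Ω₂) (x : N.ext.E) (a : N.A) :
    N.ext.E.bin o (N.ext.s (N.target x)) (N.ext.i a) = N.ext.E.bin o x (N.ext.i a) := by
  conv_rhs => rw [← N.ext.i_retr_add x]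
  rw [target_apply, map_add, add_bin, add_bin, ← i_star, N.cm3, TopOpGroup.Hom.map_bin]

theorem bin_target' (o : T.Ω₂) (x : N.ext.E) (a : N.A) :
    N.ext.E.bin o (N.ext.i a) (N.ext.s (N.target x)) = N.ext.E.bin o (N.ext.i a) x := by
  rw [← bin_flip, bin_target, bin_flip]

theorem target_ker (a : ker N.ext.p) : N.target a.1 = N.α (N.ext.retr a.1) := by
  rw [target_apply, show N.ext.p a.1 = 0 from a.2, add_zero]

/-- The kernel component as a morphism on the kernel. -/
noncomputable def kerRetr : TopOpGroup.Hom (ker N.ext.p) N.A where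
  toFun a := N.ext.retr a.1
  continuous_toFun := N.ext.continuous_retr.comp continuous_subtype_val
  map_add' a b := N.ext.i_injective <| by
    rw [map_add, N.ext.i_retr_of_p_eq_zero a.2, N.ext.i_retr_of_p_eq_zero b.2,
      N.ext.i_retr_of_p_eq_zero (a + b).2]
    rfl
  map_un' o a := N.ext.i_injective <| by
    rw [TopOpGroup.Hom.map_un, N.ext.i_retr_of_p_eq_zero a.2,
      N.ext.i_retr_of_p_eq_zero ((ker N.ext.p).un o a).2]
    rfl
  map_bin' o a b := N.ext.i_injective <| by
    rw [TopOpGroup.Hom.map_bin, N.ext.i_retr_of_p_eq_zero a.2, N.ext.i_retr_of_p_eq_zero b.2,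
      N.ext.i_retr_of_p_eq_zero ((ker N.ext.p).bin o a b).2]
    rfl

/-- The composition of the internal groupoid of a crossed module. -/
noncomputable def composition : TopOpGroup.Hom (pullback N.target N.ext.p) N.ext.E where
  toFun q := N.ext.i (N.ext.retr q.1.2) + q.1.1
  continuous_toFun := by
    have hv : Continuous (fun q : pullback N.target N.ext.p => (q.1 : N.ext.E × N.ext.E)) :=
      continuous_induced_dom
    exact (N.ext.i.continuous.comp (N.ext.continuous_retr.comp (continuous_snd.comp hv))).add
      (continuous_fst.comp hv)
  map_add' := by
    rintro ⟨⟨x, y⟩, h : N.target x = N.ext.p y⟩ ⟨⟨x', y'⟩, h' : N.target x' = N.ext.p y'⟩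
    change N.ext.i (N.ext.retr (y + y')) + (x + x') =
      N.ext.i (N.ext.retr y) + x + (N.ext.i (N.ext.retr y') + x')
    have hc := N.conj_target x (N.ext.retr y')
    rw [h] at hc
    have e : N.ext.i (N.ext.retr (y + y')) = N.ext.i (N.ext.retr y) +
        (N.ext.s (N.ext.p y) + N.ext.i (N.ext.retr y') - N.ext.s (N.ext.p y)) := by
      simp only [N.ext.i_retr, map_add, sub_eq_add_neg, add_assoc, neg_add_rev,
        neg_add_cancel_left]
    rw [e, hc]
    simp only [sub_eq_add_neg, add_assoc, neg_add_cancel_left]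
  map_un' := by
    rintro o ⟨⟨x, y⟩, h⟩
    change N.ext.i (N.ext.retr (N.ext.E.un o y)) + N.ext.E.un o x =
      N.ext.E.un o (N.ext.i (N.ext.retr y) + x)
    rw [N.ext.E.un_add]
    congr 1
    rw [N.ext.i_retr, sub_eq_iff_eq_add]
    conv_lhs => rw [← N.ext.i_retr_add y, N.ext.E.un_add]
    simp only [TopOpGroup.Hom.map_un]
  map_bin' := by
    rintro o ⟨⟨x, y⟩, h : N.target x = N.ext.p y⟩ ⟨⟨x', y'⟩, h' : N.target x' = N.ext.p y'⟩
    change N.ext.i (N.ext.retr (N.ext.E.bin o y y')) + N.ext.E.bin o x x' =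
      N.ext.E.bin o (N.ext.i (N.ext.retr y) + x) (N.ext.i (N.ext.retr y') + x')
    have e : N.ext.i (N.ext.retr (N.ext.E.bin o y y')) =
        N.ext.E.bin o (N.ext.i (N.ext.retr y)) (N.ext.i (N.ext.retr y')) +
        N.ext.E.bin o (N.ext.s (N.ext.p y)) (N.ext.i (N.ext.retr y')) +
        N.ext.E.bin o (N.ext.i (N.ext.retr y)) (N.ext.s (N.ext.p y')) := by
      rw [N.ext.i_retr, sub_eq_iff_eq_add]
      conv_lhs => rw [← N.ext.i_retr_add y, ← N.ext.i_retr_add y', N.ext.E.bin_add, add_bin,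
        add_bin]
      simp only [TopOpGroup.Hom.map_bin, add_assoc]
    rw [e, ← h, ← h', bin_target, bin_target', N.ext.E.bin_add, add_bin, add_bin]
    simp only [add_assoc]

theorem composition_mk (x y : N.ext.E) (h : N.target x = N.ext.p y) :
    N.composition (pullback.mk x y h) = N.ext.i (N.ext.retr y) + x := rfl

/-- The internal groupoid of a crossed module. -/
noncomputable def toInternalGroupoid : InternalGroupoid.{u} T where
  arr := N.ext.E
  obj := N.B
  d₀ := N.ext.p
  d₁ := N.target
  ε := N.ext.s
  comp := N.composition
  d₀_ε := N.ext.p_s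
  d₁_ε := N.target_s
  d₀_comp a b h := by rw [composition_mk, map_add, N.ext.p_i, zero_add]
  d₁_comp a b h := by rw [composition_mk, map_add, target_i, h, target_apply]
  id_comp a := by rw [composition_mk, N.ext.i_retr_add]
  comp_id a := by rw [composition_mk, N.ext.retr_s, map_zero, zero_add]
  assoc a b c h h' := by
    have e : N.ext.retr (N.ext.i (N.ext.retr c) + b) = N.ext.retr c + N.ext.retr b :=
      N.ext.retr_eq (by
        rw [map_add, map_add, N.ext.p_i, zero_add, N.ext.i_retr b, add_sub_assoc])
    simp only [composition_mk, e, map_add, add_assoc]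

end CrossedModule

namespace InternalGroupoid

theorem Hom.map_conj {H G : InternalGroupoid.{u} T} (f : Hom H G) (b : H.obj) (a : H.arr) :
    f.onArr (H.ε b + a - H.ε b) = G.ε (f.onObj b) + f.onArr a - G.ε (f.onObj b) := by
  rw [map_sub, map_add, f.map_ε]

theorem Hom.map_bin_ε {H G : InternalGroupoid.{u} T} (f : Hom H G) (o : T.Ω₂) (b : H.obj)
    (a : H.arr) :
    f.onArr (H.arr.bin o (H.ε b) a) = G.arr.bin o (G.ε (f.onObj b)) (f.onArr a) := by
  rw [TopOpGroup.Hom.map_bin, f.map_ε]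

/-- The morphism of crossed modules induced by a morphism of internal groupoids. -/
def Hom.toCrossedModule {H G : InternalGroupoid.{u} T} (f : Hom H G) :
    CrossedModule.Hom H.toCrossedModule G.toCrossedModule where
  f₁ :=
    { toFun := fun a => ⟨f.onArr a.1, (f.map_d₀ a.1).trans
        ((congrArg f.onObj a.2).trans (map_zero f.onObj))⟩
      continuous_toFun := (f.onArr.continuous.comp continuous_subtype_val).subtype_mk _
      map_add' := fun a b => Subtype.ext (map_add f.onArr a.1 b.1)
      map_un' := fun o a => Subtype.ext (f.onArr.map_un' o a.1)
      map_bin' := fun o a b => Subtype.ext (f.onArr.map_bin' o a.1 b.1) }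
  f₂ := f.onObj
  comm a := (f.map_d₁ a.1).symm
  map_dot b a := Subtype.ext (f.map_conj b a.1)
  map_star o b a := Subtype.ext (f.map_bin_ε o b a.1)

/-- The functor from internal groupoids to crossed modules in `TC`. -/
def crossedModuleFunctor : InternalGroupoid.{u} T ⥤ CrossedModule.{u} T where
  obj := toCrossedModule
  map f := Hom.toCrossedModule f

/-- The split extension of the objects by the kernel of the initial point map. -/
def splitExtension (G : InternalGroupoid.{u} T) : SplitExtension (ker G.d₀) G.obj where
  E := G.arr
  i := kerι G.d₀
  p := G.d₀
  s := G.ε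
  isEmbedding_i := Topology.IsEmbedding.subtypeVal
  exact := fun e => ⟨fun h => ⟨⟨e, h⟩, rfl⟩, fun ⟨a, h⟩ => h ▸ a.2⟩
  p_s := G.d₀_ε

section Extend

variable {H G : InternalGroupoid.{u} T}
  (f : CrossedModule.Hom H.toCrossedModule G.toCrossedModule)

/-- The extension of a morphism of crossed modules to arrows. -/
noncomputable def extendArr : TopOpGroup.Hom H.arr G.arr :=
  H.splitExtension.lift (f.f₁.comp (kerι G.d₀)) (f.f₂.comp G.ε)
    (fun b a c h => by
      have hc : c = H.toCrossedModule.act.dot b a := Subtype.ext h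
      subst hc
      exact congrArg Subtype.val (f.map_dot b a))
    (fun o b a c h => by
      have hc : c = H.toCrossedModule.act.star o b a := Subtype.ext h
      subst hc
      exact congrArg Subtype.val (f.map_star o b a))

theorem extendArr_ker (a : ker H.d₀) : extendArr f a.1 = (f.f₁ a).1 :=
  H.splitExtension.lift_i _ _ _ _ a

theorem extendArr_ε (x : H.obj) : extendArr f (H.ε x) = G.ε (f.f₂ x) :=
  H.splitExtension.lift_s _ _ _ _ x

theorem exists_ker_add (a : H.arr) : ∃ k : ker H.d₀, a = k.1 + H.ε (H.d₀ a) :=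
  ⟨_, (H.splitExtension.i_retr_add a).symm⟩

theorem d₀_extendArr (a : H.arr) : G.d₀ (extendArr f a) = f.f₂ (H.d₀ a) := by
  obtain ⟨k, hk⟩ := exists_ker_add a
  have hk0 : G.d₀ (extendArr f k.1) = 0 :=
    (congrArg G.d₀ (extendArr_ker f k)).trans (f.f₁ k).2
  conv_lhs => rw [hk]
  rw [map_add, map_add, hk0, zero_add, extendArr_ε]
  exact G.d₀_ε _

theorem d₁_extendArr (a : H.arr) : G.d₁ (extendArr f a) = f.f₂ (H.d₁ a) := by
  obtain ⟨k, hk⟩ := exists_ker_add a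
  have hk1 : G.d₁ (extendArr f k.1) = f.f₂ (H.d₁ k.1) :=
    (congrArg G.d₁ (extendArr_ker f k)).trans (f.comm k).symm
  have h2 : G.d₁ (extendArr f (H.ε (H.d₀ a))) = f.f₂ (H.d₀ a) :=
    (congrArg G.d₁ (extendArr_ε f _)).trans (G.d₁_ε _)
  have h3 : H.d₁ a = H.d₁ k.1 + H.d₀ a := by
    conv_lhs => rw [hk]
    rw [map_add, H.d₁_ε]
  conv_lhs => rw [hk]
  rw [map_add, map_add, hk1, h2, h3]
  exact (f.f₂.map_add' _ _).symm

/-- The extension of a morphism of crossed modules to internal groupoids. -/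
noncomputable def extend : Hom H G where
  onArr := extendArr f
  onObj := f.f₂
  map_d₀ := d₀_extendArr f
  map_d₁ := d₁_extendArr f
  map_ε := extendArr_ε f
  map_comp a b h := by
    rw [comp_eq, comp_eq, map_add, map_sub, extendArr_ε, d₀_extendArr]

theorem toCrossedModule_extend : (extend f).toCrossedModule = f :=
  CrossedModule.Hom.ext
    (TopOpGroup.Hom.ext (funext fun a => Subtype.ext (extendArr_ker f a))) rfl

theorem toCrossedModule_injective {f g : Hom H G} (h : f.toCrossedModule = g.toCrossedModule) :
    f = g := by
  have h₂ : f.onObj = g.onObj := congrArg CrossedModule.Hom.f₂ h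
  refine Hom.ext (TopOpGroup.Hom.ext (funext fun a => ?_)) h₂
  obtain ⟨k, hk⟩ := exists_ker_add a
  have h₁ : f.onArr k.1 = g.onArr k.1 :=
    congrArg (fun F : CrossedModule.Hom H.toCrossedModule G.toCrossedModule => (F.f₁ k).1) h
  change f.onArr a = g.onArr a
  rw [hk, map_add, map_add, h₁, f.map_ε, g.map_ε, h₂]

end Extend

instance : (crossedModuleFunctor (T := T)).Faithful where
  map_injective h := toCrossedModule_injective h

instance : (crossedModuleFunctor (T := T)).Full where
  map_surjective f := ⟨extend f, toCrossedModule_extend f⟩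

/-- The crossed module of the internal groupoid of `N` is isomorphic to `N`. -/
noncomputable def toCrossedModuleIso (N : CrossedModule.{u} T) :
    N.toInternalGroupoid.toCrossedModule ≅ N where
  hom := show CrossedModule.Hom _ _ from
    { f₁ := N.kerRetr
      f₂ := TopOpGroup.Hom.id _
      comm := fun a => N.target_ker a
      map_dot := fun b a => N.ext.i_injective <|
        (N.ext.i_retr_of_p_eq_zero (N.toInternalGroupoid.action.dot b a).2).trans
          ((congrArg (fun x : N.ext.E => N.ext.s b + x - N.ext.s b)
            (N.ext.i_retr_of_p_eq_zero a.2)).symm.trans (N.i_dot b (N.ext.retr a.1)).symm)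
      map_star := fun o b a => N.ext.i_injective <|
        (N.ext.i_retr_of_p_eq_zero (N.toInternalGroupoid.action.star o b a).2).trans
          ((congrArg (N.ext.E.bin o (N.ext.s b))
            (N.ext.i_retr_of_p_eq_zero a.2)).symm.trans (N.i_star o b (N.ext.retr a.1)).symm) }
  inv := show CrossedModule.Hom _ _ from
    { f₁ :=
        { toFun := fun a => ⟨N.ext.i a, N.ext.p_i a⟩
          continuous_toFun := N.ext.i.continuous.subtype_mk _
          map_add' := fun a b => Subtype.ext (N.ext.i.map_add' a b)
          map_un' := fun o a => Subtype.ext (N.ext.i.map_un' o a)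
          map_bin' := fun o a b => Subtype.ext (N.ext.i.map_bin' o a b) }
      f₂ := TopOpGroup.Hom.id _
      comm := fun a => (N.target_i a).symm
      map_dot := fun b a => Subtype.ext (N.i_dot b a)
      map_star := fun o b a => Subtype.ext (N.i_star o b a) }
  hom_inv_id := CrossedModule.Hom.ext (TopOpGroup.Hom.ext (funext fun a =>
    Subtype.ext (N.ext.i_retr_of_p_eq_zero a.2))) rfl
  inv_hom_id := CrossedModule.Hom.ext (TopOpGroup.Hom.ext (funext fun a => N.ext.retr_i a)) rfl

instance : (crossedModuleFunctor (T := T)).EssSurj where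
  mem_essImage N := ⟨N.toInternalGroupoid, ⟨toCrossedModuleIso N⟩⟩

instance : (crossedModuleFunctor (T := T)).IsEquivalence where

theorem d₀_add_ε (G : InternalGroupoid.{u} T) (x : G.obj) {a : G.arr} (h : G.d₀ a = 0) :
    G.d₀ (a + G.ε x) = x := by
  rw [map_add, G.d₀_ε, h, zero_add]

theorem d₀_sub_ε (G : InternalGroupoid.{u} T) (x : G.obj) {a : G.arr} (h : G.d₀ a = x) :
    G.d₀ (a - G.ε x) = 0 := by
  rw [map_sub, G.d₀_ε, h, sub_self]

/-- Translation by an identity arrow identifies a star with the star of zero. -/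
def starHomeomorph (G : InternalGroupoid.{u} T) (x : G.obj) : ker G.d₀ ≃ₜ G.Star x where
  toFun a := ⟨a.1 + G.ε x, G.d₀_add_ε x a.2⟩
  invFun a := ⟨a.1 - G.ε x, G.d₀_sub_ε x a.2⟩
  left_inv a := Subtype.ext (add_sub_cancel_right a.1 (G.ε x))
  right_inv a := Subtype.ext (sub_add_cancel a.1 (G.ε x))
  continuous_toFun := (continuous_subtype_val.add continuous_const).subtype_mk _
  continuous_invFun := (continuous_subtype_val.sub continuous_const).subtype_mk _

theorem starMap_starHomeomorph {H G : InternalGroupoid.{u} T} (f : Hom H G) (x : H.obj) :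
    f.starMap x ∘ H.starHomeomorph x =
      G.starHomeomorph (f.onObj x) ∘ f.toCrossedModule.f₁ := by
  funext a
  refine Subtype.ext ((map_add f.onArr a.1 (H.ε x)).trans ?_)
  rw [f.map_ε]
  rfl

theorem isCovering_iff_isCover {H G : InternalGroupoid.{u} T} (f : Hom H G) :
    f.IsCovering ↔ f.toCrossedModule.IsCover := by
  have key : ∀ x, IsHomeomorph (f.starMap x) ↔ IsHomeomorph f.toCrossedModule.f₁ := fun x => by
    have h := starMap_starHomeomorph f x
    constructor
    · intro hf
      have e : (f.toCrossedModule.f₁ : ker H.d₀ → ker G.d₀) =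
          (G.starHomeomorph (f.onObj x)).symm ∘ (f.starMap x ∘ H.starHomeomorph x) := by
        rw [h]
        funext a
        exact ((G.starHomeomorph (f.onObj x)).symm_apply_apply _).symm
      exact e ▸ (G.starHomeomorph (f.onObj x)).symm.isHomeomorph.comp
        (hf.comp (H.starHomeomorph x).isHomeomorph)
    · intro hf
      have e : f.starMap x = (f.starMap x ∘ H.starHomeomorph x) ∘ (H.starHomeomorph x).symm := by
        funext a
        exact congrArg (f.starMap x) ((H.starHomeomorph x).apply_symm_apply a).symm
      rw [e, h]
      exact ((G.starHomeomorph (f.onObj x)).isHomeomorph.comp hf).comp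
        (H.starHomeomorph x).symm.isHomeomorph
  exact ⟨fun h => (isIso_iff_isHomeomorph _).2 ((key 0).1 (h 0)),
    fun h x => (key x).2 ((isIso_iff_isHomeomorph _).1 h)⟩

end InternalGroupoid

namespace CrossedModule

/-- The functor that sends a crossed module to its source. -/
def source : CrossedModule.{u} T ⥤ TopOpGroup.{u} T where
  obj M := M.A
  map f := Hom.f₁ f

instance (M : CrossedModule.{u} T) : ObjectProperty.IsClosedUnderIsomorphisms
    (C := Over M) (fun p => Hom.IsCover p.hom) where
  of_iso {p q} e hp := by
    have hp' : IsIso (source.map p.hom) := hp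
    have h : q.hom = e.inv.left ≫ p.hom := (Over.w e.inv).symm
    change IsIso (source.map q.hom)
    rw [h, Functor.map_comp]
    have : IsIso (source.map e.inv.left) := ((Over.forget M ⋙ source).mapIso e).isIso_inv
    exact IsIso.comp_isIso

end CrossedModule

/-- Coverings of an internal groupoid are equivalent to covers of its crossed module. -/
noncomputable def InternalGroupoid.covEquivalence (G : InternalGroupoid.{u} T) :
    InternalGroupoid.Cov G ≌ CrossedModule.Cov G.toCrossedModule :=
  Equivalence.congrFullSubcategory
    (Over.post (X := G) (crossedModuleFunctor (T := T))).asEquivalence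
    (funext fun p => propext (isCovering_iff_isCover p.hom).symm)

end TopOps

theorem mainTheorem3 (T : TopOps.OpTheory.{v, w}) (G : TopOps.InternalGroupoid.{u} T) :
    Nonempty (TopOps.InternalGroupoid.Cov G ≌ TopOps.CrossedModule.Cov G.toCrossedModule) :=
  ⟨G.covEquivalence⟩
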